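/- A dicot is a finite graph with two kinds of edges, solid and dashed, such that the solid edges and the dashed edges each form a simple graph and the union of the two graphs is bipartite. Suppose each vertex $v$ has a real weight $x(v)$, each solid edge $vv'$ a real weight $a(v,v')=a(v',v)$ and a direction, and each dashed edge $vv'$ a real weight $b(v,v')=b(v',v)$. A monopole-dimer configuration is a family of vertex-disjoint directed loops of even length (a loop of length $2$ being a doubled edge, i.e. an edge traversed back and forth), each containing an even number of dashed edges; the vertices on no loop are called isolated. A loop $\ell=(v_1,\dots,v_{2p})$ with edges $e_i$ from $v_i$ to $v_{i+1}$ (where $v_{2p+1}=v_1$) has weight $$w(\ell)=-\prod_{i=1}^{2p}\begin{cases}a(v_i,v_{i+1}) & e_i \text{ solid, directed from } v_i \text{ to } v_{i+1},\\ -a(v_i,v_{i+1}) & e_i \text{ solid, directed from } v_{i+1} \text{ to } v_i,\\ \sqrt{-1}\,b(v_i,v_{i+1}) & e_i\text{ dashed.}\end{cases}$$ The weight of a configuration is the product of the weights of its loops and of the vertex weights of its isolated vertices. The partition function is the sum of the weights of all configurations. For $m,n\ge 0$ and real $a,b_1,b_2,x$ (in particular, for positive weights), let $\mathcal Q^{(v)}_{m,n}$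 be the dicot whose vertices are those of the grid with $m$ columns and $n$ rows, whose solid edges are all horizontal and vertical grid edges, and which has one dashed edge parallel to each vertical edge. All vertices have weight $x$, horizontal edges weight $a$, vertical solid edges weight $b_1$, and dashed edges weight $b_2$. The vertices are labelled row by row, the first row from left to right, the second from right to left, and so on alternately, and each solid edge is directed from its smaller to its larger label. **Theorem.** Put $|b|=\sqrt{b_1^2+b_2^2}$ and $Y_m(b,c;x)=\prod_{j=1}^{\lfloor m/2\rfloor}\left(x^2+4(b^2+c^2)\cos^2\frac{j\pi}{m+1}\right)$. Then the partition function of the monopole-dimer model on $\mathcal Q^{(v)}_{m,n}$ is $$\mathcal Z^{(v)}_{m,n}=\prod_{j=1}^{\lfloor m/2\rfloor}\prod_{k=1}^{\lfloor n/2\rfloor}\left(x^2+4a^2\cos^2\frac{j\pi}{m+1}+4|b|^2\cos^2\frac{k\pi}{n+1}\right)^2\times\begin{cases}1 & m,n \text{ even},\\ Y_m(a,0;x) & m \text{ even},\ n\text{ odd},\\ Y_n(b_1,b_2;x) & m\text{ odd},\ n\text{ even},\\ x\,Y_m(a,0;x)\,Y_n(b_1,b_2;x) & m,n\text{ odd}.\end{cases}$$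 -/

import Mathlib

open scoped BigOperators

noncomputable section

/-- A weighted, oriented dicot on the vertex set `V`: two simple graphs, of solid and of dashed
edges, whose union is bipartite; a direction for every solid edge; real weights on the vertices
and (symmetric) real weights on the solid and on the dashed edges.  The edge weights matter only
at pairs that are joined by an edge of that kind. -/
structure Dicot (V : Type*) where
  solid : SimpleGraph V
  dashed : SimpleGraph V
  bipartite : (solid ⊔ dashed).IsBipartite
  /-- `arrow u v` says that the solid edge `uv` is directed from `u` to `v`. -/
  arrow : V → V → Prop
  arrow_xor : ∀ u v, solid.Adj u v → Xor (arrow u v) (arrow v u)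
  vertexWeight : V → ℝ
  solidWeight : V → V → ℝ
  solidWeight_symm : ∀ u v, solidWeight u v = solidWeight v u
  dashedWeight : V → V → ℝ
  dashedWeight_symm : ∀ u v, dashedWeight u v = dashedWeight v u

namespace Dicot

variable {V : Type*} [Fintype V] [DecidableEq V]

/-- A monopole-dimer configuration: a family of vertex-disjoint directed loops of even length
(a loop of length 2 is a doubled edge), each with an even number of dashed edges.

The directed loops are the nontrivial cycles of the permutation `next`, which sends a vertex to
its successor on its loop; the isolated vertices are the fixed points of `next`.
A vertex `v` that is not isolated lies in `dashedFrom` when the edge of the configuration from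
`v` to `next v` is dashed, and outside of it when this edge is solid. -/
structure Configuration (G : Dicot V) where
  next : Equiv.Perm V
  dashedFrom : Finset V
  dashedFrom_subset : dashedFrom ⊆ next.support
  dashed_adj : ∀ v ∈ dashedFrom, G.dashed.Adj v (next v)
  solid_adj : ∀ v ∈ next.support, v ∉ dashedFrom → G.solid.Adj v (next v)
  even_length : ∀ l ∈ next.cycleFactorsFinset, Even l.support.card
  even_dashed : ∀ l ∈ next.cycleFactorsFinset, Even (l.support ∩ dashedFrom).card

instance (G : Dicot V) : Fintype G.Configuration :=
  Fintype.ofInjective (fun C => (C.next, C.dashedFrom)) (by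
    rintro ⟨s, D, _, _, _, _, _⟩ ⟨s', D', _, _, _, _, _⟩ h
    simp only [Prod.mk.injEq] at h
    obtain ⟨rfl, rfl⟩ := h
    rfl)

open Classical in
/-- The factor that the edge of `C` leaving the vertex `v` contributes to its loop. -/
def stepWeight (G : Dicot V) (C : G.Configuration) (v : V) : ℂ :=
  if v ∈ C.dashedFrom then Complex.I * (G.dashedWeight v (C.next v) : ℂ)
  else if G.arrow v (C.next v) then (G.solidWeight v (C.next v) : ℂ)
  else -(G.solidWeight v (C.next v) : ℂ)

/-- The weight of the loop `l` of `C`. -/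
def loopWeight (G : Dicot V) (C : G.Configuration) (l : Equiv.Perm V) : ℂ :=
  -∏ v ∈ l.support, G.stepWeight C v

/-- The weight of a configuration: the product of the weights of its loops and of the vertex
weights of its isolated vertices. -/
def configurationWeight (G : Dicot V) (C : G.Configuration) : ℂ :=
  (∏ l ∈ C.next.cycleFactorsFinset, G.loopWeight C l) *
    ∏ v ∈ Finset.univ.filter (fun v => C.next v = v), (G.vertexWeight v : ℂ)

/-- The partition function of the monopole-dimer model on `G`. -/
def partitionFunction (G : Dicot V) : ℂ :=
  ∑ C : G.Configuration, G.configurationWeight C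

end Dicot

/-- The standard labels of the vertices of the grid with `m` columns and `n` rows, starting from
`0`: rows are labelled one after the other, alternately from left to right and from right to left.
The vertex `(j, k)` is in column `j` and row `k`. -/
def gridLabel (m n : ℕ) (v : Fin m × Fin n) : ℕ :=
  m * v.2 + if Even (v.2 : ℕ) then (v.1 : ℕ) else m - 1 - v.1

theorem gridLabel_injective (m n : ℕ) : Function.Injective (gridLabel m n) := by
  have key : ∀ v : Fin m × Fin n, gridLabel m n v / m = v.2 := by
    rintro ⟨⟨j, hj⟩, k⟩
    have h : (if Even (k : ℕ) then j else m - 1 - j) < m := by split_ifs <;> omega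
    simp only [gridLabel]
    rw [Nat.mul_add_div (by omega), Nat.div_eq_of_lt h, add_zero]
  intro u v h
  have h2 : (u.2 : ℕ) = v.2 := by rw [← key u, ← key v, h]
  obtain ⟨⟨j, hj⟩, k⟩ := u
  obtain ⟨⟨j', hj'⟩, k'⟩ := v
  obtain rfl : k = k' := Fin.ext h2
  simp only [gridLabel] at h
  have : j = j' := by split_ifs at h <;> omega
  subst this
  rfl

/-- The dicot on the grid with `m` columns and `n` rows: all horizontal and vertical grid edges
are solid, and there is a dashed edge parallel to each vertical one.  Horizontal edges have weight
`a`, vertical solid edges `b₁`, vertical dashed edges `b₂`, and vertices `x`.  Solid edges point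
from the smaller to the larger label. -/
def gridDicot (m n : ℕ) (a b₁ b₂ x : ℝ) : Dicot (Fin m × Fin n) where
  solid := (SimpleGraph.pathGraph m).boxProd (SimpleGraph.pathGraph n)
  dashed := (⊥ : SimpleGraph (Fin m)).boxProd (SimpleGraph.pathGraph n)
  bipartite := by
    refine ⟨SimpleGraph.Coloring.mk
      (fun v => (⟨((v.1 : ℕ) + v.2) % 2, Nat.mod_lt _ two_pos⟩ : Fin 2)) ?_⟩
    rintro ⟨⟨j, hj⟩, ⟨k, hk⟩⟩ ⟨⟨j', hj'⟩, ⟨k', hk'⟩⟩ h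
    simp only [SimpleGraph.sup_adj, SimpleGraph.boxProd_adj, SimpleGraph.pathGraph_adj,
      SimpleGraph.bot_adj, Fin.mk.injEq] at h
    simp only [ne_eq, Fin.mk.injEq, false_and, or_false, false_or] at h ⊢
    rcases h with (⟨h, h'⟩ | ⟨h, h'⟩) | ⟨h, h'⟩ <;> omega
  arrow u v := gridLabel m n u < gridLabel m n v
  arrow_xor u v h := by
    have : gridLabel m n u ≠ gridLabel m n v := fun e => h.ne (gridLabel_injective m n e)
    rcases lt_or_gt_of_ne this with h' | h'
    · exact Or.inl ⟨h', h'.asymm⟩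
    · exact Or.inr ⟨h', h'.asymm⟩
  vertexWeight _ := x
  solidWeight u v := if u.2 = v.2 then a else b₁
  solidWeight_symm u v := by simp only [eq_comm]
  dashedWeight _ _ := b₂
  dashedWeight_symm _ _ := rfl

/-- `Y_m(b, c; x) = ∏_{j=1}^{⌊m/2⌋} (x² + 4 (b² + c²) cos² (jπ/(m+1)))`. -/
def gridY (m : ℕ) (b c x : ℝ) : ℝ :=
  ∏ j ∈ Finset.Icc 1 (m / 2),
    (x ^ 2 + 4 * (b ^ 2 + c ^ 2) * Real.cos (j * Real.pi / (m + 1)) ^ 2)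

end

/-!
The partition function of any dicot is the determinant of its signed weighted adjacency matrix
(`Dicot.partitionFunction_eq_det`). In the expansion of this determinant over permutations, each
entry is split into its solid and its dashed part. Since the union graph is bipartite, the
nontrivial cycles of a permutation with nonzero contribution have even length, hence sign `-1`,
and the terms with an even number of dashed edges on every cycle are the weights of the
configurations. In the other terms some cycle has an odd number of dashed edges, hence an odd
number of solid ones. As the solid part is antisymmetric and the dashed part symmetric, reversing
such a cycle changes the sign, and these terms cancel in pairs (`Dicot.sum_term_oddSet_nonempty`).

For the grid with `m` columns and `n` rows, the matrix is `x 1 + a T ⊗ S + 1 ⊗ V`, where `T` is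
the antisymmetric matrix of a directed path, `S = diag (1, -1, 1, …)` and `V` has constant entries
`b₁ + i b₂` above and `-b₁ + i b₂` below the diagonal. The matrix `-i T` is Hermitian with
eigenvalues `2 cos (j π / (m + 1))`. Diagonalizing it leaves, for each `j`, an `n × n` tridiagonal
determinant whose diagonal alternates between `x + c` and `x - c` with
`c = 2 i a cos (j π / (m + 1))` (`det_gridMatrix`). Up to a factor `x + c` for odd `n`, such a
determinant depends only on `(x + c) (x - c) = x² + 4 a² cos² (j π / (m + 1))`. So it is obtained
from the case of a constant diagonal, which is a Chebyshev polynomial of the second kind with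
known roots (`altContinuant_eq_prod_even`, `altContinuant_eq_prod_odd`). Finally the factors for
`j` and `m + 1 - j` are multiplied together (`prod_altContinuant`).
-/

noncomputable section

/-! ### Tridiagonal determinants with alternating diagonal -/

/-- The tridiagonal matrix with alternating diagonal `p, q, p, …`, all entries above the diagonal
equal to `α` and all entries below it equal to `γ`. -/
def altTridiagonal {R : Type*} [CommRing R] (p q α γ : R) (n : ℕ) : Matrix (Fin n) (Fin n) R :=
  Matrix.of fun i j =>
    if i = j then (if Even (i : ℕ) then p else q)
    else if (i : ℕ) + 1 = j then α else if (j : ℕ) + 1 = i then γ else 0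

/-- The determinant of `altTridiagonal p q α γ n`, as a function of `w = -α γ`, by the recursion
that expansion along the first row gives. -/
def altContinuant {R : Type*} [CommRing R] (w : R) : ℕ → R → R → R
  | 0, _, _ => 1
  | 1, p, _ => p
  | n + 2, p, q => p * altContinuant w (n + 1) q p + w * altContinuant w n p q

theorem det_altTridiagonal_add_two {R : Type*} [CommRing R] (p q α γ : R) (n : ℕ) :
    (altTridiagonal p q α γ (n + 2)).det =
      p * (altTridiagonal q p α γ (n + 1)).det
        + -(α * γ) * (altTridiagonal p q α γ n).det := by
  have h1 : (altTridiagonal p q α γ (n + 2)).submatrix Fin.succ (Fin.succAbove 0) =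
      altTridiagonal q p α γ (n + 1) := by
    ext i j
    simp [altTridiagonal, Nat.even_add_one, -Nat.not_even_iff_odd]
  have h2 : ((altTridiagonal p q α γ (n + 2)).submatrix Fin.succ (Fin.succAbove 1)).det =
      γ * (altTridiagonal p q α γ n).det := by
    rw [Matrix.det_succ_column_zero, Fin.sum_univ_succ, Finset.sum_eq_zero]
    · have h3 : ((altTridiagonal p q α γ (n + 2)).submatrix Fin.succ
          (Fin.succAbove 1)).submatrix (Fin.succAbove 0) Fin.succ = altTridiagonal p q α γ n := by
        ext i j
        have hj : (Fin.succAbove (1 : Fin (n + 2)) j.succ) = j.succ.succ := by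
          rw [Fin.succAbove_of_lt_succ]
          simp [Fin.lt_def]
        simp [altTridiagonal, Nat.even_add_one, hj]
      rw [h3]
      simp [altTridiagonal]
    · intro i _
      simp [altTridiagonal, Fin.ext_iff]
  rw [Matrix.det_succ_row_zero, Fin.sum_univ_succ, Fin.sum_univ_succ, Finset.sum_eq_zero, h1]
  · rw [show (Fin.succ 0 : Fin (n + 2)) = 1 from rfl, h2]
    simp [altTridiagonal]
    ring
  · intro i _
    simp [altTridiagonal, Fin.ext_iff]

theorem det_altTridiagonal {R : Type*} [CommRing R] (p q α γ : R) (n : ℕ) :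
    (altTridiagonal p q α γ n).det = altContinuant (-(α * γ)) n p q := by
  induction n using Nat.twoStepInduction generalizing p q with
  | zero => simp [altContinuant]
  | one => simp [altContinuant, altTridiagonal]
  | more n h0 h1 => rw [det_altTridiagonal_add_two, h0, h1, altContinuant]

theorem altContinuant_smul {R : Type*} [CommRing R] (t w p q : R) (n : ℕ) :
    altContinuant (t ^ 2 * w) n (t * p) (t * q) = t ^ n * altContinuant w n p q := by
  induction n using Nat.twoStepInduction generalizing p q with
  | zero => simp [altContinuant]
  | one => simp [altContinuant]
  | more n h0 h1 => simp only [altContinuant, h0, h1]; ring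

theorem altContinuant_neg_one_eq_eval_U {R : Type*} [CommRing R] (z : R) (n : ℕ) :
    altContinuant (-1) n (2 * z) (2 * z) = (Polynomial.Chebyshev.U R n).eval z := by
  induction n using Nat.twoStepInduction with
  | zero => simp [altContinuant]
  | one => simp [altContinuant]
  | more n h0 h1 =>
    have := Polynomial.Chebyshev.U_add_two R n
    push_cast at h1 ⊢
    simp [altContinuant, h0, h1, this]
    ring

/-! ### Chebyshev polynomials and products of cosines -/

theorem eval_U_eq_prod (n : ℕ) (z : ℂ) :
    (Polynomial.Chebyshev.U ℂ n).eval z =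
      ∏ k ∈ Finset.Icc 1 n, (2 * (z - Real.cos (k * Real.pi / (n + 1)))) := by
  have hnd := Polynomial.Chebyshev.roots_U_real_nodup n
  have hr : (Polynomial.Chebyshev.U ℝ n).roots = Multiset.map
      (fun k : ℕ => Real.cos ((k + 1) * Real.pi / (n + 1))) (.range n) := by
    rw [Polynomial.Chebyshev.roots_U_real, Finset.image_val, Finset.range_val,
      Multiset.dedup_eq_self.mpr hnd]
  have hU := Polynomial.C_leadingCoeff_mul_prod_multiset_X_sub_C
    (p := Polynomial.Chebyshev.U ℝ n) (by simp [hr])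
  rw [← Polynomial.Chebyshev.map_U Complex.ofRealHom, ← hU, hr, Multiset.map_map,
    Finset.prod_mul_distrib, Finset.prod_const, ← Finset.Ico_add_one_right_eq_Icc,
    Finset.prod_Ico_eq_prod_range]
  have h2 : (Multiset.map ((fun a => Polynomial.X - Polynomial.C a) ∘ fun k : ℕ =>
      Real.cos ((k + 1) * Real.pi / (n + 1))) (.range n)).prod =
      ∏ k ∈ Finset.range n,
        (Polynomial.X - Polynomial.C (Real.cos ((k + 1) * Real.pi / (n + 1)))) := rfl
  rw [h2]
  simp [Polynomial.map_prod, Polynomial.eval_prod, add_comm]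

/-- The product over `1, …, 2 r`, with the factors at `k` and `2 r + 1 - k` paired. -/
theorem prod_Icc_two_mul {M : Type*} [CommMonoid M] (f : ℕ → M) (r : ℕ) :
    ∏ k ∈ Finset.Icc 1 (2 * r), f k = ∏ k ∈ Finset.Icc 1 r, (f k * f (2 * r + 1 - k)) := by
  simp only [← Finset.Ico_add_one_right_eq_Icc, Finset.prod_Ico_eq_prod_range,
    Finset.prod_mul_distrib, Nat.add_sub_cancel]
  rw [two_mul, Finset.prod_range_add, ← Finset.prod_range_reflect (fun k => f (1 + (r + k)))]
  congr 1
  refine Finset.prod_congr rfl fun k hk => ?_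
  rw [Finset.mem_range] at hk
  congr 1
  omega

/-- The product over `1, …, 2 r + 1`, with the factors at `k` and `2 r + 2 - k` paired. -/
theorem prod_Icc_two_mul_add_one {M : Type*} [CommMonoid M] (f : ℕ → M) (r : ℕ) :
    ∏ k ∈ Finset.Icc 1 (2 * r + 1), f k =
      (∏ k ∈ Finset.Icc 1 r, (f k * f (2 * r + 2 - k))) * f (r + 1) := by
  simp only [← Finset.Ico_add_one_right_eq_Icc, Finset.prod_Ico_eq_prod_range,
    Finset.prod_mul_distrib, Nat.add_sub_cancel]
  rw [show 2 * r + 1 = (r + 1) + r by omega, Finset.prod_range_add, Finset.prod_range_succ,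
    ← Finset.prod_range_reflect (fun k => f (1 + (r + 1 + k))), mul_right_comm, add_comm 1 r]
  congr 2
  refine Finset.prod_congr rfl fun k hk => ?_
  rw [Finset.mem_range] at hk
  congr 1
  omega

theorem cos_reflect (n k : ℕ) (hk : k ≤ n + 1) :
    Real.cos (((n + 1 - k : ℕ) : ℝ) * Real.pi / (n + 1)) =
      -Real.cos (k * Real.pi / (n + 1)) := by
  rw [← Real.cos_pi_sub, Nat.cast_sub hk]
  congr 1
  push_cast
  field_simp

/-- For a constant diagonal the determinant is a homogenized Chebyshev polynomial of the second
kind. -/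
theorem altContinuant_self_eq_prod (n : ℕ) (s t : ℂ) :
    altContinuant (-t ^ 2) n s s =
      ∏ k ∈ Finset.Icc 1 n, (s - 2 * t * Real.cos (k * Real.pi / (n + 1))) := by
  rcases eq_or_ne t 0 with rfl | ht
  · suffices ∀ n, altContinuant (0 : ℂ) n s s = s ^ n by simpa using this n
    intro n
    induction n using Nat.twoStepInduction with
    | zero => simp [altContinuant]
    | one => simp [altContinuant]
    | more n h0 h1 => rw [altContinuant, h1]; ring
  · have h1 : s = t * (2 * (s / (2 * t))) := by field_simp
    rw [show -t ^ 2 = t ^ 2 * (-1) by ring]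
    conv_lhs => rw [h1]
    rw [altContinuant_smul, altContinuant_neg_one_eq_eval_U, eval_U_eq_prod]
    have h2 : t ^ n = ∏ k ∈ Finset.Icc 1 n, t := by simp
    rw [h2, ← Finset.prod_mul_distrib]
    refine Finset.prod_congr rfl fun k _ => ?_
    field_simp

/-- The determinants of size `2 r` and `2 r + 1`, the latter without its factor `p`, depend on `p`
and `q` only through `u = p q`. The two components are these polynomials in `u`, in this order. -/
def altContinuantParts {R : Type*} [CommRing R] (w u : R) : ℕ → R × R
  | 0 => (1, 1)
  | r + 1 =>
    let E := u * (altContinuantParts w u r).2 + w * (altContinuantParts w u r).1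
    (E, E + w * (altContinuantParts w u r).2)

theorem altContinuant_eq_parts {R : Type*} [CommRing R] (w p q : R) (r : ℕ) :
    altContinuant w (2 * r) p q = (altContinuantParts w (p * q) r).1 ∧
      altContinuant w (2 * r + 1) p q = p * (altContinuantParts w (p * q) r).2 := by
  induction r generalizing p q with
  | zero => simp [altContinuant, altContinuantParts]
  | succ r ih =>
    have h : altContinuant w (2 * (r + 1)) p q = (altContinuantParts w (p * q) (r + 1)).1 := by
      rw [show 2 * (r + 1) = 2 * r + 2 by ring, altContinuant, (ih q p).2, (ih p q).1]
      simp only [altContinuantParts, mul_comm q p]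
      ring
    have h' : altContinuant w (2 * (r + 1)) q p = (altContinuantParts w (p * q) (r + 1)).1 := by
      rw [show 2 * (r + 1) = 2 * r + 2 by ring, altContinuant, (ih p q).2, (ih q p).1]
      simp only [altContinuantParts, mul_comm q p]
      ring
    refine ⟨h, ?_⟩
    rw [show 2 * (r + 1) + 1 = 2 * r + 1 + 2 by ring, altContinuant, (ih p q).2,
      show 2 * r + 1 + 1 = 2 * (r + 1) by ring, h']
    simp only [altContinuantParts]
    ring

theorem continuous_altContinuantParts (w : ℂ) (r : ℕ) :
    Continuous fun u => altContinuantParts w u r := by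
  induction r with
  | zero => exact continuous_const
  | succ r ih => simp only [altContinuantParts]; fun_prop

theorem altContinuantParts_fst_eq_prod (w u : ℂ) (r : ℕ) :
    (altContinuantParts w u r).1 = ∏ k ∈ Finset.Icc 1 r,
      (u + 4 * w * (Real.cos (k * Real.pi / ((2 * r : ℕ) + 1)) : ℂ) ^ 2) := by
  -- With `u = s²` and `w = -t²` both diagonal entries may be taken to be `s`.
  obtain ⟨s, rfl⟩ := IsAlgClosed.exists_pow_nat_eq u two_pos
  obtain ⟨t, ht⟩ := IsAlgClosed.exists_pow_nat_eq (-w) two_pos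
  obtain rfl : w = -t ^ 2 := by rw [ht, neg_neg]
  rw [pow_two s, ← (altContinuant_eq_parts _ s s r).1, altContinuant_self_eq_prod,
    prod_Icc_two_mul]
  refine Finset.prod_congr rfl fun k hk => ?_
  rw [Finset.mem_Icc] at hk
  rw [cos_reflect _ _ (by omega)]
  push_cast
  ring

theorem altContinuantParts_snd_eq_prod (w u : ℂ) (r : ℕ) :
    (altContinuantParts w u r).2 = ∏ k ∈ Finset.Icc 1 r,
      (u + 4 * w * (Real.cos (k * Real.pi / ((2 * r + 1 : ℕ) + 1)) : ℂ) ^ 2) := by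
  suffices h : (fun s : ℂ => (altContinuantParts w (s ^ 2) r).2) = fun s => ∏ k ∈ Finset.Icc 1 r,
      (s ^ 2 + 4 * w * (Real.cos (k * Real.pi / ((2 * r + 1 : ℕ) + 1)) : ℂ) ^ 2) by
    obtain ⟨s, rfl⟩ := IsAlgClosed.exists_pow_nat_eq u two_pos
    exact congrFun h s
  -- The constant-diagonal determinant gives the identity multiplied by `s`; the case `s = 0`
  -- follows by continuity.
  refine Continuous.ext_on (dense_compl_singleton (0 : ℂ))
    ((continuous_altContinuantParts w r).comp (continuous_pow 2)).snd (by fun_prop) ?_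
  intro s hs
  obtain ⟨t, ht⟩ := IsAlgClosed.exists_pow_nat_eq (-w) two_pos
  obtain rfl : w = -t ^ 2 := by rw [ht, neg_neg]
  refine mul_left_cancel₀ (show s ≠ 0 from hs) ?_
  simp only
  rw [pow_two s, ← (altContinuant_eq_parts _ s s r).2, altContinuant_self_eq_prod,
    prod_Icc_two_mul_add_one]
  have hmid : Real.cos (((r + 1 : ℕ) : ℝ) * Real.pi / ((2 * r + 1 : ℕ) + 1)) = 0 := by
    rw [← Real.cos_pi_div_two]
    congr 1
    push_cast
    field_simp
    ring
  rw [hmid, mul_comm]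
  congr 1
  · simp
  · refine Finset.prod_congr rfl fun k hk => ?_
    rw [Finset.mem_Icc] at hk
    rw [show 2 * r + 2 - k = 2 * r + 1 + 1 - k by omega, cos_reflect _ _ (by omega)]
    push_cast
    ring

theorem altContinuant_eq_prod_even (w p q : ℂ) {n : ℕ} (hn : Even n) :
    altContinuant w n p q = ∏ k ∈ Finset.Icc 1 (n / 2),
      (p * q + 4 * w * (Real.cos (k * Real.pi / (n + 1)) : ℂ) ^ 2) := by
  obtain ⟨r, rfl⟩ := hn.two_dvd
  rw [(altContinuant_eq_parts w p q r).1, altContinuantParts_fst_eq_prod]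
  simp

theorem altContinuant_eq_prod_odd (w p q : ℂ) {n : ℕ} (hn : Odd n) :
    altContinuant w n p q = p * ∏ k ∈ Finset.Icc 1 (n / 2),
      (p * q + 4 * w * (Real.cos (k * Real.pi / (n + 1)) : ℂ) ^ 2) := by
  obtain ⟨r, rfl⟩ := hn
  rw [(altContinuant_eq_parts w p q r).2, altContinuantParts_snd_eq_prod]
  rw [show (2 * r + 1) / 2 = r by omega]

/-! ### Diagonalization in the horizontal direction -/

section Kronecker

open scoped Kronecker

/-- Diagonalizing the Hermitian factor `H` splits the determinant into one block per eigenvalue. -/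
theorem det_kronecker_add_one_kronecker {ι κ : Type*} [Fintype ι] [DecidableEq ι] [Fintype κ]
    [DecidableEq κ] {H : Matrix ι ι ℂ} (hH : H.IsHermitian) (A M : Matrix κ κ ℂ) :
    (H ⊗ₖ A + 1 ⊗ₖ M).det = ∏ i, ((hH.eigenvalues i : ℂ) • A + M).det := by
  set U : Matrix ι ι ℂ := (hH.eigenvectorUnitary : Matrix ι ι ℂ)
  set d : ι → ℂ := fun i => (hH.eigenvalues i : ℂ)
  have hU : U * star U = 1 := Unitary.coe_mul_star_self _
  have hspec : H = U * Matrix.diagonal d * star U := by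
    have := hH.spectral_theorem
    rw [Unitary.conjStarAlgAut_apply] at this
    exact this
  have hfac : H ⊗ₖ A + 1 ⊗ₖ M =
      (U ⊗ₖ (1 : Matrix κ κ ℂ)) * (Matrix.diagonal d ⊗ₖ A + 1 ⊗ₖ M) *
        (star U ⊗ₖ (1 : Matrix κ κ ℂ)) := by
    simp only [mul_add, add_mul, ← Matrix.mul_kronecker_mul, one_mul, mul_one, hU]
    rw [← hspec]
  have hdet : (U ⊗ₖ (1 : Matrix κ κ ℂ)).det * (star U ⊗ₖ (1 : Matrix κ κ ℂ)).det = 1 := by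
    rw [← Matrix.det_mul, ← Matrix.mul_kronecker_mul, hU, one_mul, Matrix.one_kronecker_one,
      Matrix.det_one]
  have hmid : Matrix.diagonal d ⊗ₖ A + 1 ⊗ₖ M =
      Matrix.reindex (Equiv.prodComm _ _) (Equiv.prodComm _ _)
        (Matrix.blockDiagonal fun i => d i • A + M) := by
    ext ⟨i, k⟩ ⟨i', k'⟩
    by_cases h : i = i' <;> simp [Matrix.blockDiagonal_apply, Matrix.diagonal, h]
  rw [hfac, Matrix.det_mul, Matrix.det_mul, mul_right_comm, hdet, one_mul, hmid,
    Matrix.det_reindex_self, Matrix.det_blockDiagonal]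

theorem isHermitian_altTridiagonal (m : ℕ) :
    (altTridiagonal 0 0 (-Complex.I) Complex.I m).IsHermitian := by
  ext i j
  simp only [altTridiagonal, Matrix.conjTranspose_apply, Matrix.of_apply]
  rcases eq_or_ne i j with rfl | h
  · simp
  · have : (i : ℕ) ≠ j := fun e => h (Fin.ext e)
    rw [if_neg h, if_neg h.symm]
    split_ifs <;> first | omega | simp

/-- The eigenvalues of the Hermitian matrix of a directed path are, with multiplicities, the numbers
`2 cos (j π / (m + 1))`. -/
theorem prod_eigenvalues_eq_prod_cos (m : ℕ) (f : ℂ → ℂ) :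
    ∏ i, f ((isHermitian_altTridiagonal m).eigenvalues i) =
      ∏ j ∈ Finset.Icc 1 m, f (2 * Real.cos (j * Real.pi / (m + 1))) := by
  have hH := isHermitian_altTridiagonal m
  have hchar : (altTridiagonal 0 0 (-Complex.I) Complex.I m).charpoly =
      ∏ j ∈ Finset.Icc 1 m,
        (Polynomial.X - Polynomial.C (2 * Real.cos (j * Real.pi / (m + 1)) : ℂ)) := by
    refine Polynomial.funext fun s => ?_
    have h : Matrix.scalar (Fin m) s - altTridiagonal 0 0 (-Complex.I) Complex.I m =
        altTridiagonal s s Complex.I (-Complex.I) m := by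
      ext i j
      rcases eq_or_ne i j with rfl | h
      · simp [altTridiagonal]
      · simp [altTridiagonal, h]
        split_ifs <;> simp
    rw [Matrix.eval_charpoly, h, det_altTridiagonal, Polynomial.eval_prod]
    have := altContinuant_self_eq_prod m s 1
    simpa using this
  -- Comparing the roots of the two factorizations gives equality of multisets.
  have hroots := congrArg Polynomial.roots (hH.charpoly_eq.symm.trans hchar)
  rw [Finset.prod_eq_multiset_prod, Finset.prod_eq_multiset_prod] at hroots
  have h1 := Polynomial.roots_multiset_prod_X_sub_C
    (Multiset.map (fun i => (hH.eigenvalues i : ℂ)) Finset.univ.val)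
  have h2 := Polynomial.roots_multiset_prod_X_sub_C
    (Multiset.map (fun j : ℕ => (2 * Real.cos (j * Real.pi / (m + 1)) : ℂ)) (Finset.Icc 1 m).val)
  rw [Multiset.map_map] at h1 h2
  have h3 := (h1.symm.trans hroots).trans h2
  have h4 := congrArg (fun s => (Multiset.map f s).prod) h3
  rw [Multiset.map_map, Multiset.map_map] at h4
  exact h4

/-- The matrix `x 1 + a T ⊗ S + 1 ⊗ V` of the grid, where `T` has entries `1` above and `-1` below
the diagonal, `S` is diagonal with entries `1, -1, 1, …`, as the direction of the horizontal edges
alternates with the row, and `V` has entries `β` above and `γ` below the diagonal. The two factors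
of `T ⊗ S` are multiplied by `-i` and `i`, which makes the first one Hermitian. -/
def gridMatrix (m n : ℕ) (a x β γ : ℂ) : Matrix (Fin m × Fin n) (Fin m × Fin n) ℂ :=
  altTridiagonal 0 0 (-Complex.I) Complex.I m ⊗ₖ
      altTridiagonal (a * Complex.I) (-(a * Complex.I)) 0 0 n
    + 1 ⊗ₖ altTridiagonal x x β γ n

theorem det_gridMatrix (m n : ℕ) (a x β γ : ℂ) :
    (gridMatrix m n a x β γ).det = ∏ j ∈ Finset.Icc 1 m,
      altContinuant (-(β * γ)) n
        (x + 2 * a * Complex.I * Real.cos (j * Real.pi / (m + 1)))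
        (x - 2 * a * Complex.I * Real.cos (j * Real.pi / (m + 1))) := by
  rw [gridMatrix, det_kronecker_add_one_kronecker (isHermitian_altTridiagonal m),
    prod_eigenvalues_eq_prod_cos m
      (fun c => (c • altTridiagonal (a * Complex.I) (-(a * Complex.I)) 0 0 n +
        altTridiagonal x x β γ n).det)]
  refine Finset.prod_congr rfl fun j _ => ?_
  rw [← det_altTridiagonal]
  congr 1
  ext k l
  rcases eq_or_ne k l with rfl | h
  · simp only [altTridiagonal, Matrix.add_apply, Matrix.smul_apply, Matrix.of_apply, if_true,
      smul_eq_mul, ite_self]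
    split_ifs <;> ring
  · simp [altTridiagonal, h]

end Kronecker

/-- The factors at `j` and `m + 1 - j` have the same product of diagonal entries, so their product
is a polynomial in the squared cosine; for odd `m` the cosine of the middle factor vanishes. -/
theorem prod_altContinuant (m n : ℕ) (a x b₁ b₂ : ℝ) :
    ∏ j ∈ Finset.Icc 1 m, altContinuant ((b₁ : ℂ) ^ 2 + (b₂ : ℂ) ^ 2) n
        (x + 2 * a * Complex.I * Real.cos (j * Real.pi / (m + 1)))
        (x - 2 * a * Complex.I * Real.cos (j * Real.pi / (m + 1))) =
    (((∏ j ∈ Finset.Icc 1 (m / 2), ∏ k ∈ Finset.Icc 1 (n / 2),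
          (x ^ 2 + 4 * a ^ 2 * Real.cos (j * Real.pi / (m + 1)) ^ 2
            + 4 * Real.sqrt (b₁ ^ 2 + b₂ ^ 2) ^ 2 * Real.cos (k * Real.pi / (n + 1)) ^ 2) ^ 2) *
        (if Even m then
          if Even n then 1 else gridY m a 0 x
        else
          if Even n then gridY n b₁ b₂ x else x * gridY m a 0 x * gridY n b₁ b₂ x) : ℝ) : ℂ) := by
  rw [Real.sq_sqrt (by positivity)]
  set g : ℝ → ℂ := fun t => altContinuant ((b₁ : ℂ) ^ 2 + (b₂ : ℂ) ^ 2) n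
        (x + 2 * a * Complex.I * t) (x - 2 * a * Complex.I * t) with hg
  have hpair : ∀ t : ℝ, g t * g (-t) = (((∏ k ∈ Finset.Icc 1 (n / 2),
      (x ^ 2 + 4 * a ^ 2 * t ^ 2
        + 4 * (b₁ ^ 2 + b₂ ^ 2) * Real.cos (k * Real.pi / (n + 1)) ^ 2) ^ 2) *
      (if Even n then 1 else x ^ 2 + 4 * (a ^ 2 + 0 ^ 2) * t ^ 2) : ℝ) : ℂ) := by
    intro t
    have hpq : ((x : ℂ) + 2 * a * Complex.I * t) * (x - 2 * a * Complex.I * t) =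
        x ^ 2 + 4 * a ^ 2 * t ^ 2 := by
      linear_combination (-4 * (a : ℂ) ^ 2 * t ^ 2) * Complex.I_sq
    have hqp := (mul_comm _ _).trans hpq
    simp only [hg, Complex.ofReal_neg, mul_neg, sub_neg_eq_add, ← sub_eq_add_neg]
    rcases Nat.even_or_odd n with hn | hn
    · rw [altContinuant_eq_prod_even _ _ _ hn, altContinuant_eq_prod_even _ _ _ hn, hqp, hpq,
        if_pos hn, Finset.prod_pow]
      push_cast
      ring
    · rw [altContinuant_eq_prod_odd _ _ _ hn, altContinuant_eq_prod_odd _ _ _ hn, hqp, hpq,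
        if_neg (Nat.not_even_iff_odd.mpr hn), Finset.prod_pow]
      push_cast
      rw [mul_mul_mul_comm, hpq]
      ring
  have hmid : g 0 = (((if Even n then 1 else x) * gridY n b₁ b₂ x : ℝ) : ℂ) := by
    simp only [hg, gridY, Complex.ofReal_zero, mul_zero, add_zero, sub_zero]
    rcases Nat.even_or_odd n with hn | hn
    · rw [altContinuant_eq_prod_even _ _ _ hn, if_pos hn]
      push_cast
      simp only [one_mul, ← pow_two]
    · rw [altContinuant_eq_prod_odd _ _ _ hn, if_neg (Nat.not_even_iff_odd.mpr hn)]
      push_cast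
      simp only [← pow_two]
  have hprod : ∏ j ∈ Finset.Icc 1 (m / 2), (g (Real.cos (j * Real.pi / (m + 1))) *
      g (-Real.cos (j * Real.pi / (m + 1)))) =
      (((∏ j ∈ Finset.Icc 1 (m / 2), ∏ k ∈ Finset.Icc 1 (n / 2),
          (x ^ 2 + 4 * a ^ 2 * Real.cos (j * Real.pi / (m + 1)) ^ 2
            + 4 * (b₁ ^ 2 + b₂ ^ 2) * Real.cos (k * Real.pi / (n + 1)) ^ 2) ^ 2) *
        (if Even n then 1 else gridY m a 0 x) : ℝ) : ℂ) := by
    simp only [hpair]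
    rw [← Complex.ofReal_prod, Finset.prod_mul_distrib]
    congr 2
    split_ifs
    · simp
    · rfl
  change ∏ j ∈ Finset.Icc 1 m, g (Real.cos (j * Real.pi / (m + 1))) = _
  rcases Nat.even_or_odd' m with ⟨r, rfl | rfl⟩
  · rw [prod_Icc_two_mul, if_pos (even_two_mul r), ← hprod, Nat.mul_div_cancel_left r two_pos]
    refine Finset.prod_congr rfl fun k hk => ?_
    rw [Finset.mem_Icc] at hk
    rw [cos_reflect _ _ (by omega)]
  · have hcos : Real.cos (((r + 1 : ℕ) : ℝ) * Real.pi / ((2 * r + 1 : ℕ) + 1)) = 0 := by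
      rw [← Real.cos_pi_div_two]
      congr 1
      push_cast
      field_simp
      ring
    have h := hprod
    rw [show (2 * r + 1) / 2 = r by omega] at h ⊢
    rw [prod_Icc_two_mul_add_one, hcos, hmid, if_neg (Nat.not_even_iff_odd.mpr ⟨r, rfl⟩)]
    have h2 : ∏ k ∈ Finset.Icc 1 r, (g (Real.cos (k * Real.pi / ((2 * r + 1 : ℕ) + 1))) *
        g (Real.cos ((2 * r + 2 - k : ℕ) * Real.pi / ((2 * r + 1 : ℕ) + 1)))) =
        ∏ k ∈ Finset.Icc 1 r, (g (Real.cos (k * Real.pi / ((2 * r + 1 : ℕ) + 1))) *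
        g (-Real.cos (k * Real.pi / ((2 * r + 1 : ℕ) + 1)))) := by
      refine Finset.prod_congr rfl fun k hk => ?_
      rw [Finset.mem_Icc] at hk
      rw [show 2 * r + 2 - k = 2 * r + 1 + 1 - k by omega, cos_reflect _ _ (by omega)]
    rw [h2, h, ← Complex.ofReal_mul]
    congr 1
    split_ifs <;> ring

/-! ### Reversing a cycle of a permutation -/

namespace Equiv.Perm
variable {V : Type*}

/-- An equivalence relation that relates every point to its image contains `SameCycle`. -/
theorem SameCycle.of_equivalence [Finite V] {σ : Perm V} {r : V → V → Prop} (hr : Equivalence r)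
    (h : ∀ u, r u (σ u)) {u w : V} (huw : σ.SameCycle u w) : r u w := by
  obtain ⟨n, -, rfl⟩ := huw.exists_pow_eq'
  clear huw
  induction n with
  | zero => exact hr.refl u
  | succ n ih =>
    rw [pow_succ', mul_apply]
    exact hr.trans ih (h _)

theorem sameCycle_equivalence (σ : Perm V) : Equivalence σ.SameCycle :=
  ⟨SameCycle.refl σ, SameCycle.symm, SameCycle.trans⟩

variable [Fintype V] [DecidableEq V]

/-- The permutation `σ` with the direction of its cycle through `v` reversed: on this cycle it is
`σ * σ⁻¹ ^ 2 = σ⁻¹`, and it agrees with `σ` elsewhere. -/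
def reverseCycle (σ : Perm V) (v : V) : Perm V := σ * (σ.cycleOf v)⁻¹ ^ 2

theorem reverseCycle_apply_of_sameCycle {σ : Perm V} {v u : V} (h : σ.SameCycle v u) :
    σ.reverseCycle v u = σ.symm u := by
  have h1 : ∀ w, σ.SameCycle v w → (σ.cycleOf v)⁻¹ w = σ.symm w := by
    intro w hw
    rw [inv_def, symm_apply_eq, SameCycle.cycleOf_apply (sameCycle_symm_apply_right.mpr hw),
      apply_symm_apply]
  rw [reverseCycle, pow_two, mul_apply, mul_apply, h1 u h,
    h1 _ (sameCycle_symm_apply_right.mpr h), apply_symm_apply]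

theorem reverseCycle_apply_of_not_sameCycle {σ : Perm V} {v u : V} (h : ¬ σ.SameCycle v u) :
    σ.reverseCycle v u = σ u := by
  have h1 : (σ.cycleOf v)⁻¹ u = u := by
    rw [inv_def, symm_apply_eq, cycleOf_apply_of_not_sameCycle h]
  rw [reverseCycle, pow_two, mul_apply, mul_apply, h1, h1]

theorem sign_reverseCycle (σ : Perm V) (v : V) : sign (σ.reverseCycle v) = sign σ := by
  simp [reverseCycle, sign_mul]

theorem sameCycle_reverseCycle {σ : Perm V} {v u w : V} :
    (σ.reverseCycle v).SameCycle u w ↔ σ.SameCycle u w := by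
  constructor
  · refine SameCycle.of_equivalence (sameCycle_equivalence σ) fun u => ?_
    by_cases h : σ.SameCycle v u
    · rw [reverseCycle_apply_of_sameCycle h]
      exact sameCycle_symm_apply_right.mpr (SameCycle.refl _ _)
    · rw [reverseCycle_apply_of_not_sameCycle h]
      exact sameCycle_apply_right.mpr (SameCycle.refl _ _)
  · refine SameCycle.of_equivalence (sameCycle_equivalence _) fun u => ?_
    by_cases h : σ.SameCycle v u
    · have h' : σ.reverseCycle v (σ u) = u := by
        rw [reverseCycle_apply_of_sameCycle (sameCycle_apply_right.mpr h), symm_apply_apply]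
      have h2 := (SameCycle.refl (σ.reverseCycle v) (σ u)).apply_left
      rwa [h'] at h2
    · rw [← reverseCycle_apply_of_not_sameCycle h]
      exact sameCycle_apply_right.mpr (SameCycle.refl _ _)

theorem reverseCycle_reverseCycle (σ : Perm V) (v : V) :
    (σ.reverseCycle v).reverseCycle v = σ := by
  ext u
  by_cases h : σ.SameCycle v u
  · rw [reverseCycle_apply_of_sameCycle (sameCycle_reverseCycle.mpr h), symm_apply_eq,
      reverseCycle_apply_of_sameCycle (sameCycle_apply_right.mpr h), symm_apply_apply]
  · rw [reverseCycle_apply_of_not_sameCycle (sameCycle_reverseCycle.not.mpr h),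
      reverseCycle_apply_of_not_sameCycle h]

/-- The points of the cycle of `σ` through `v`; this is `{v}` when `v` is a fixed point. -/
def cycleSet (σ : Perm V) (v : V) : Finset V := Finset.univ.filter (σ.SameCycle v)

theorem mem_cycleSet {σ : Perm V} {v u : V} : u ∈ cycleSet σ v ↔ σ.SameCycle v u := by
  simp [cycleSet]

theorem cycleSet_reverseCycle (σ : Perm V) (v u : V) :
    cycleSet (σ.reverseCycle v) u = cycleSet σ u := by
  ext w
  simp [mem_cycleSet, sameCycle_reverseCycle]

theorem support_eq_cycleSet {σ l : Perm V}
    (hl : l ∈ σ.cycleFactorsFinset) {v : V} (hv : v ∈ l.support) : l.support = cycleSet σ v := by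
  have hσ := mem_cycleFactorsFinset_support_le hl hv
  ext u
  rw [cycle_is_cycleOf hv hl, mem_support_cycleOf_iff, mem_cycleSet]
  exact ⟨fun h => h.1, fun h => ⟨h, hσ⟩⟩

/-- A cycle of even length has sign `-1`, the sign in the weight of a loop. -/
theorem sign_mul_prod_support {σ : Perm V}
    (heven : ∀ l ∈ σ.cycleFactorsFinset, Even l.support.card) (f : V → ℂ) :
    ((sign σ : ℤ) : ℂ) * ∏ v ∈ σ.support, f v =
      ∏ l ∈ σ.cycleFactorsFinset, -∏ v ∈ l.support, f v := by
  have hsign : ((sign σ : ℤ) : ℂ) = ∏ l ∈ σ.cycleFactorsFinset, (-1 : ℂ) := by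
    rw [sign_of_cycleType', cycleType_def, Multiset.map_map]
    change (((∏ l ∈ σ.cycleFactorsFinset, -(-1 : ℤˣ) ^ l.support.card : ℤˣ) : ℤ) : ℂ) = _
    rw [Finset.prod_congr rfl fun l hl => by rw [(heven l hl).neg_one_pow]]
    simp
  have hdisj : (σ.cycleFactorsFinset : Set (Perm V)).PairwiseDisjoint support := by
    intro l hl l' hl' hne
    exact (cycleFactorsFinset_pairwise_disjoint σ hl hl' hne).disjoint_support
  have hunion : σ.support = σ.cycleFactorsFinset.biUnion support := by
    ext v
    rw [Finset.mem_biUnion]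
    refine ⟨fun hv => ⟨σ.cycleOf v, cycleOf_mem_cycleFactorsFinset_iff.mpr hv, ?_⟩, ?_⟩
    · exact mem_support_cycleOf_iff.mpr ⟨SameCycle.refl _ _, hv⟩
    · rintro ⟨l, hl, hv⟩
      exact mem_cycleFactorsFinset_support_le hl hv
  rw [hsign, hunion, Finset.prod_biUnion hdisj, ← Finset.prod_mul_distrib]
  simp

end Equiv.Perm

/-! ### The determinant of a dicot -/

namespace Dicot

open Equiv Equiv.Perm

section Reversal

variable {V : Type*} [Fintype V] [DecidableEq V]

/-- Reversal of the loop through `v` in a pair `(σ, D)` of a permutation and a set of vertices. The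
set `D` consists of the vertices whose outgoing edge is dashed; as the edge from `u` to `σ u`
becomes the edge from `σ u` to `u`, the set changes along with `σ`. -/
def reverseAt (v : V) (p : Perm V × Finset V) : Perm V × Finset V :=
  (p.1.reverseCycle v,
    Finset.univ.filter fun u => if p.1.SameCycle v u then p.1.symm u ∈ p.2 else u ∈ p.2)

theorem mem_reverseAt_snd {v u : V} {p : Perm V × Finset V} :
    u ∈ (reverseAt v p).2 ↔ if p.1.SameCycle v u then p.1.symm u ∈ p.2 else u ∈ p.2 := by
  simp [reverseAt]

theorem reverseAt_reverseAt (v : V) (p : Perm V × Finset V) :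
    reverseAt v (reverseAt v p) = p := by
  refine Prod.ext (reverseCycle_reverseCycle p.1 v) ?_
  ext u
  rw [mem_reverseAt_snd]
  by_cases h : p.1.SameCycle v u
  · have h' : (reverseAt v p).1.SameCycle v u := sameCycle_reverseCycle.mpr h
    have h2 : (reverseAt v p).1.symm u = p.1 u := by
      rw [symm_apply_eq, reverseAt,
        reverseCycle_apply_of_sameCycle (sameCycle_apply_right.mpr h), symm_apply_apply]
    rw [if_pos h', h2, mem_reverseAt_snd, if_pos (sameCycle_apply_right.mpr h), symm_apply_apply]
  · have h' : ¬ (reverseAt v p).1.SameCycle v u := sameCycle_reverseCycle.not.mpr h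
    rw [if_neg h', mem_reverseAt_snd, if_neg h]

/-- The vertices whose cycle carries an odd number of dashed edges. -/
def oddSet (p : Perm V × Finset V) : Finset V :=
  Finset.univ.filter fun u => Odd (cycleSet p.1 u ∩ p.2).card

/-- Reversing a loop changes neither the vertex sets of the loops nor the number of dashed edges on
them. This makes a reversal at a vertex chosen from `oddSet p` an involution. -/
theorem oddSet_reverseAt (v : V) (p : Perm V × Finset V) : oddSet (reverseAt v p) = oddSet p := by
  ext u
  simp only [oddSet, Finset.mem_filter, Finset.mem_univ, true_and]
  suffices h : (cycleSet (reverseAt v p).1 u ∩ (reverseAt v p).2).card =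
      (cycleSet p.1 u ∩ p.2).card by rw [h]
  have hc : cycleSet (reverseAt v p).1 u = cycleSet p.1 u := cycleSet_reverseCycle _ _ _
  rw [hc]
  by_cases huv : p.1.SameCycle v u
  · symm
    refine Finset.card_bij (fun w _ => p.1 w) ?_ (fun _ _ _ _ h => p.1.injective h) ?_
    · intro w hw
      rw [Finset.mem_inter, mem_cycleSet] at hw
      rw [Finset.mem_inter, mem_cycleSet, mem_reverseAt_snd,
        if_pos (sameCycle_apply_right.mpr (huv.trans hw.1)), symm_apply_apply]
      exact ⟨sameCycle_apply_right.mpr hw.1, hw.2⟩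
    · intro w hw
      rw [Finset.mem_inter, mem_cycleSet, mem_reverseAt_snd] at hw
      rw [if_pos (huv.trans hw.1)] at hw
      refine ⟨p.1.symm w, ?_, apply_symm_apply _ _⟩
      rw [Finset.mem_inter, mem_cycleSet]
      exact ⟨sameCycle_symm_apply_right.mpr hw.1, hw.2⟩
  · congr 1
    ext w
    simp only [Finset.mem_inter, mem_cycleSet, mem_reverseAt_snd]
    refine and_congr_right fun hw => ?_
    rw [if_neg fun h => huv (h.trans hw.symm)]

end Reversal

variable {V : Type*} (G : Dicot V)

open Classical in
/-- The contribution of the dashed edges to the entry `(u, v)` of `kasteleyn`. -/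
def dashedEntry (u v : V) : ℂ :=
  if G.dashed.Adj u v then Complex.I * G.dashedWeight u v else 0

theorem dashedEntry_symm (u v : V) : G.dashedEntry v u = G.dashedEntry u v := by
  simp only [dashedEntry, G.dashedWeight_symm v u]
  rw [G.dashed.adj_comm v u]

variable [DecidableEq V]

open Classical in
/-- The contribution of the vertex weights and of the solid edges to the entry `(u, v)` of
`kasteleyn`. -/
def solidEntry (u v : V) : ℂ :=
  if u = v then G.vertexWeight u
  else if G.solid.Adj u v then (if G.arrow u v then (G.solidWeight u v : ℂ) else -G.solidWeight u v)
  else 0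

theorem solidEntry_symm {u v : V} (h : u ≠ v) : G.solidEntry v u = -G.solidEntry u v := by
  by_cases hs : G.solid.Adj u v
  · have := G.arrow_xor u v hs
    simp only [solidEntry, if_neg h, if_neg h.symm, if_pos hs, if_pos hs.symm,
      G.solidWeight_symm v u]
    rcases this with ⟨h1, h2⟩ | ⟨h1, h2⟩ <;> simp [h1, h2]
  · have hs' : ¬ G.solid.Adj v u := fun h' => hs h'.symm
    simp [solidEntry, if_neg h, if_neg h.symm, if_neg hs, if_neg hs']

/-- The signed weighted adjacency matrix of a dicot: its vertex weights stand on the diagonal, its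
solid edges give an antisymmetric part and its dashed edges a symmetric one. -/
def kasteleyn : Matrix V V ℂ := Matrix.of fun u v => G.solidEntry u v + G.dashedEntry u v

variable [Fintype V]

/-- The factor of the expansion term of `p` at the vertex `v`: the dashed part of the matrix entry
for `v ∈ p.2`, and the solid part otherwise. -/
def stepEntry (p : Perm V × Finset V) (v : V) : ℂ :=
  if v ∈ p.2 then G.dashedEntry v (p.1 v) else G.solidEntry v (p.1 v)

/-- The term that the permutation `p.1` contributes to the determinant of `kasteleyn` when the
dashed part of the entry is chosen at the vertices of `p.2` and the solid part elsewhere. -/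
def term (p : Perm V × Finset V) : ℂ := ((sign p.1 : ℤ) : ℂ) * ∏ v, G.stepEntry p v

theorem det_kasteleyn_eq_sum_term : G.kasteleyn.det = ∑ p : Perm V × Finset V, G.term p := by
  rw [← Matrix.det_transpose, Matrix.det_apply', Fintype.sum_prod_type]
  refine Finset.sum_congr rfl fun σ _ => ?_
  have := Finset.prod_add (fun v => G.dashedEntry v (σ v)) (fun v => G.solidEntry v (σ v))
    Finset.univ
  simp only [kasteleyn, Matrix.transpose_apply, Matrix.of_apply, term]
  rw [← Finset.mul_sum]
  congr 1
  simp only [add_comm (G.solidEntry _ _)]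
  rw [this, Finset.powerset_univ]
  refine Finset.sum_congr rfl fun D _ => ?_
  simp only [stepEntry]
  rw [Finset.prod_ite]
  congr 1
  · congr 1; ext; simp
  · congr 1; ext; simp

/-- A nonzero term follows edges of the dicot, of the chosen kinds. -/
theorem adj_of_term_ne_zero {p : Perm V × Finset V} (h : G.term p ≠ 0) (v : V) :
    (v ∈ p.2 → G.dashed.Adj v (p.1 v)) ∧
      (v ∉ p.2 → p.1 v ≠ v → G.solid.Adj v (p.1 v)) := by
  have hv : G.stepEntry p v ≠ 0 :=
    Finset.prod_ne_zero_iff.mp (right_ne_zero_of_mul h) v (Finset.mem_univ v)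
  constructor
  · intro hD
    by_contra hadj
    exact hv (by simp [stepEntry, hD, dashedEntry, hadj])
  · intro hD hne
    by_contra hadj
    exact hv (by simp [stepEntry, hD, solidEntry, hadj, hne.symm])

/-- In a nonzero term a set of moved vertices that is invariant under the permutation, for instance
a loop, has even size: the permutation swaps the two colour classes of the bipartite union graph. -/
theorem even_card_of_term_ne_zero {p : Perm V × Finset V} (h : G.term p ≠ 0) (S : Finset V)
    (hS : ∀ v, p.1 v ∈ S ↔ v ∈ S) (hne : ∀ v ∈ S, p.1 v ≠ v) : Even S.card := by
  obtain ⟨f⟩ := G.bipartite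
  have hf : ∀ v ∈ S, f v ≠ f (p.1 v) := by
    intro v hv
    apply f.valid
    by_cases hD : v ∈ p.2
    · exact Or.inr ((G.adj_of_term_ne_zero h v).1 hD)
    · exact Or.inl ((G.adj_of_term_ne_zero h v).2 hD (hne v hv))
  have hcard : (S.filter fun v => f v = 0).card = (S.filter fun v => ¬ f v = 0).card := by
    refine Finset.card_bij (fun v _ => p.1 v) ?_ (fun _ _ _ _ h => p.1.injective h) ?_
    · intro v hv
      rw [Finset.mem_filter] at hv ⊢
      exact ⟨(hS v).mpr hv.1, fun h0 => hf v hv.1 (hv.2.trans h0.symm)⟩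
    · intro w hw
      rw [Finset.mem_filter] at hw
      have hv : p.1.symm w ∈ S := (hS _).mp (by rw [apply_symm_apply]; exact hw.1)
      refine ⟨p.1.symm w, ?_, apply_symm_apply _ _⟩
      rw [Finset.mem_filter]
      have := hf _ hv
      rw [apply_symm_apply] at this
      refine ⟨hv, ?_⟩
      have h2 := hw.2
      generalize f w = c at *
      generalize f (p.1.symm w) = d at *
      omega
  rw [← Finset.card_filter_add_card_filter_not (s := S) (fun v => f v = 0), hcard]
  exact ⟨_, rfl⟩

/-- Reversing a loop changes the sign of each of its solid steps and keeps its dashed steps. -/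
theorem prod_stepEntry_reverseAt {v : V} {p : Perm V × Finset V} (hv : p.1 v ≠ v) :
    ∏ u, G.stepEntry (reverseAt v p) u =
      (-1) ^ (cycleSet p.1 v \ p.2).card * ∏ u, G.stepEntry p u := by
  rw [← Finset.prod_filter_mul_prod_filter_not Finset.univ (p.1.SameCycle v),
    ← Finset.prod_filter_mul_prod_filter_not Finset.univ (p.1.SameCycle v) (G.stepEntry p),
    ← mul_assoc]
  congr 1
  · have h1 : ∀ u ∈ cycleSet p.1 v, G.stepEntry (reverseAt v p) (p.1 u) =
        (if u ∈ p.2 then 1 else -1) * G.stepEntry p u := by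
      intro u hu
      rw [mem_cycleSet] at hu
      have hu' := sameCycle_apply_right.mpr hu
      have hne : p.1 u ≠ u := fun h => hv ((hu.apply_eq_self_iff).mpr h)
      have happ : (reverseAt v p).1 (p.1 u) = u := by
        rw [reverseAt, reverseCycle_apply_of_sameCycle hu', symm_apply_apply]
      have hmem : p.1 u ∈ (reverseAt v p).2 ↔ u ∈ p.2 := by
        rw [mem_reverseAt_snd, if_pos hu', symm_apply_apply]
      simp only [stepEntry, hmem, happ]
      split_ifs
      · rw [G.dashedEntry_symm, one_mul]
      · rw [G.solidEntry_symm hne.symm, neg_one_mul]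
    have h2 : ∏ u ∈ cycleSet p.1 v, (if u ∈ p.2 then (1 : ℂ) else -1) =
        (-1) ^ (cycleSet p.1 v \ p.2).card := by
      rw [Finset.prod_ite, Finset.prod_const_one, one_mul, Finset.prod_const,
        Finset.sdiff_eq_filter]
    change ∏ u ∈ cycleSet p.1 v, _ = _ * ∏ u ∈ cycleSet p.1 v, _
    rw [← h2, ← Finset.prod_mul_distrib]
    refine Finset.prod_bij' (fun u _ => p.1.symm u) (fun u _ => p.1 u) ?_ ?_ ?_ ?_ ?_
    · intro u hu
      rw [mem_cycleSet] at hu ⊢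
      exact sameCycle_symm_apply_right.mpr hu
    · intro u hu
      rw [mem_cycleSet] at hu ⊢
      exact sameCycle_apply_right.mpr hu
    · simp
    · simp
    · intro u hu
      have h3 : p.1.symm u ∈ cycleSet p.1 v := by
        rw [mem_cycleSet] at hu ⊢
        exact sameCycle_symm_apply_right.mpr hu
      rw [← h1 _ h3, apply_symm_apply]
  · refine Finset.prod_congr rfl fun u hu => ?_
    rw [Finset.mem_filter] at hu
    have happ : (reverseAt v p).1 u = p.1 u := reverseCycle_apply_of_not_sameCycle hu.2
    simp only [stepEntry, mem_reverseAt_snd, if_neg hu.2, happ]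

/-- A loop of even length with an odd number of dashed edges has an odd number of solid ones, so its
reversal changes the sign of the term. -/
theorem term_reverseAt {v : V} {p : Perm V × Finset V} (hp : G.term p ≠ 0)
    (hv : v ∈ oddSet p) : G.term (reverseAt v p) = -G.term p := by
  have hodd : Odd (cycleSet p.1 v ∩ p.2).card := (Finset.mem_filter.mp hv).2
  have hne : p.1 v ≠ v := by
    intro hfix
    have hset : cycleSet p.1 v = {v} := by
      ext u
      rw [mem_cycleSet, Finset.mem_singleton]
      exact ⟨fun h => (h.eq_of_left hfix).symm, fun h => h ▸ SameCycle.refl _ _⟩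
    -- A fixed point in `oddSet p` would be joined to itself by a dashed edge.
    have hmem : v ∈ p.2 := by
      by_contra hmem
      rw [hset, Finset.singleton_inter_of_notMem hmem] at hodd
      simp at hodd
    have := (G.adj_of_term_ne_zero hp v).1 hmem
    rw [hfix] at this
    exact this.ne rfl
  have heven : Even (cycleSet p.1 v).card := by
    refine G.even_card_of_term_ne_zero hp _ (fun u => ?_) (fun u hu h => ?_)
    · rw [mem_cycleSet, mem_cycleSet, sameCycle_apply_right]
    · exact hne ((mem_cycleSet.mp hu).apply_eq_self_iff.mpr h)
  have hsolid : Odd (cycleSet p.1 v \ p.2).card := by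
    have h := Finset.card_sdiff_add_card_inter (cycleSet p.1 v) p.2
    rw [← h] at heven
    exact Nat.not_even_iff_odd.mp fun h' =>
      Nat.not_even_iff_odd.mpr hodd ((Nat.even_add.mp heven).mp h')
  rw [term, G.prod_stepEntry_reverseAt hne, hsolid.neg_one_pow, term]
  simp only [reverseAt, sign_reverseCycle]
  ring

theorem term_add_term_reverseAt {v : V} {p : Perm V × Finset V} (hv : v ∈ oddSet p) :
    G.term p + G.term (reverseAt v p) = 0 := by
  by_cases hp : G.term p = 0
  · by_cases hq : G.term (reverseAt v p) = 0
    · rw [hp, hq, add_zero]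
    · have := G.term_reverseAt hq (by rwa [oddSet_reverseAt])
      rw [reverseAt_reverseAt, hp, eq_comm, neg_eq_zero] at this
      exact absurd this hq
  · rw [G.term_reverseAt hp hv, add_neg_cancel]

/-- The terms with an odd number of dashed edges on some loop cancel in pairs. -/
theorem sum_term_oddSet_nonempty :
    ∑ p ∈ Finset.univ.filter (fun p : Perm V × Finset V => (oddSet p).Nonempty), G.term p = 0 := by
  -- The vertex is chosen as a function of `oddSet p` alone, which the reversal preserves, so that
  -- reversing twice restores `p`.
  refine Finset.sum_involution
    (fun p hp => reverseAt (Finset.mem_filter.mp hp).2.choose p) ?_ ?_ ?_ ?_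
  · intro p hp
    exact G.term_add_term_reverseAt (Finset.mem_filter.mp hp).2.choose_spec
  · intro p hp h0 h
    have := G.term_add_term_reverseAt (Finset.mem_filter.mp hp).2.choose_spec
    rw [h] at this
    exact h0 (self_eq_neg.mp (eq_neg_of_add_eq_zero_left this))
  · intro p hp
    simpa [oddSet_reverseAt] using hp
  · intro p hp
    simp only [oddSet_reverseAt]
    exact reverseAt_reverseAt _ _

theorem configurationWeight_eq_term (C : G.Configuration) :
    G.configurationWeight C = G.term (C.next, C.dashedFrom) := by
  have hstep : ∀ v ∈ C.next.support,
      G.stepEntry (C.next, C.dashedFrom) v = G.stepWeight C v := by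
    intro v hv
    by_cases hD : v ∈ C.dashedFrom
    · simp [stepEntry, stepWeight, hD, dashedEntry, C.dashed_adj v hD]
    · have hne : v ≠ C.next v := (mem_support.mp hv).symm
      simp [stepEntry, stepWeight, hD, solidEntry, C.solid_adj v hv hD, hne]
  have hfix : ∀ v ∈ Finset.univ.filter (fun v => C.next v = v),
      G.stepEntry (C.next, C.dashedFrom) v = (G.vertexWeight v : ℂ) := by
    intro v hv
    have hv' : C.next v = v := (Finset.mem_filter.mp hv).2
    have hD : v ∉ C.dashedFrom := fun h => mem_support.mp (C.dashedFrom_subset h) hv'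
    simp [stepEntry, hD, solidEntry, hv']
  rw [term, ← Finset.prod_filter_not_mul_prod_filter Finset.univ (fun v => C.next v = v),
    Finset.prod_congr rfl hfix, ← mul_assoc, configurationWeight]
  congr 1
  change _ = _ * ∏ v ∈ C.next.support, _
  rw [Finset.prod_congr rfl hstep, sign_mul_prod_support C.even_length]
  rfl

theorem not_nonempty_oddSet (C : G.Configuration) : ¬ (oddSet (C.next, C.dashedFrom)).Nonempty := by
  rintro ⟨v, hv⟩
  have hodd : Odd (cycleSet C.next v ∩ C.dashedFrom).card := (Finset.mem_filter.mp hv).2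
  by_cases hs : v ∈ C.next.support
  · have hl := cycleOf_mem_cycleFactorsFinset_iff.mpr hs
    have := C.even_dashed _ hl
    rw [support_eq_cycleSet hl (mem_support_cycleOf_iff.mpr ⟨SameCycle.refl _ _, hs⟩)] at this
    exact Nat.not_even_iff_odd.mpr hodd this
  · have hempty : cycleSet C.next v ∩ C.dashedFrom = ∅ := by
      rw [Finset.eq_empty_iff_forall_notMem]
      intro u hu
      rw [Finset.mem_inter, mem_cycleSet] at hu
      exact hs (hu.1.mem_support_iff.mpr (C.dashedFrom_subset hu.2))
    rw [hempty] at hodd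
    simp at hodd

/-- A nonzero term with an even number of dashed edges on every loop comes from a configuration. -/
theorem exists_configuration {p : Perm V × Finset V} (hp : G.term p ≠ 0)
    (hodd : ¬ (oddSet p).Nonempty) :
    ∃ C : G.Configuration, (C.next, C.dashedFrom) = p := by
  have hadj := G.adj_of_term_ne_zero hp
  refine ⟨⟨p.1, p.2, fun v hv => ?_, fun v hv => (hadj v).1 hv,
    fun v hv hD => (hadj v).2 hD (mem_support.mp hv), fun l hl => ?_, fun l hl => ?_⟩, rfl⟩
  · exact mem_support.mpr ((hadj v).1 hv).ne'
  · refine G.even_card_of_term_ne_zero hp _ (fun v => ?_) (fun v hv => ?_)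
    · have := zpow_apply_mem_support_of_mem_cycleFactorsFinset_iff (x := v) (m := 1) (c := ⟨l, hl⟩)
      simpa using this
    · exact mem_support.mp (mem_cycleFactorsFinset_support_le hl hv)
  · obtain ⟨v, hv⟩ := (mem_cycleFactorsFinset_iff.mp hl).1.nonempty_support
    rw [support_eq_cycleSet hl hv]
    by_contra h
    exact hodd ⟨v, Finset.mem_filter.mpr ⟨Finset.mem_univ v, Nat.not_even_iff_odd.mp h⟩⟩

/-- The monopole-dimer model of every finite dicot has a determinantal partition function. -/
theorem partitionFunction_eq_det : G.partitionFunction = G.kasteleyn.det := by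
  rw [det_kasteleyn_eq_sum_term, partitionFunction,
    ← Finset.sum_filter_add_sum_filter_not Finset.univ
      (fun p : Perm V × Finset V => (oddSet p).Nonempty), sum_term_oddSet_nonempty, zero_add]
  refine Finset.sum_of_injOn (fun C => (C.next, C.dashedFrom)) ?_ ?_ ?_ ?_
  · rintro ⟨s, D, _, _, _, _, _⟩ - ⟨s', D', _, _, _, _, _⟩ - h
    simp only [Prod.mk.injEq] at h
    obtain ⟨rfl, rfl⟩ := h
    rfl
  · intro C _
    simpa using G.not_nonempty_oddSet C
  · intro p hp hnot
    by_contra h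
    obtain ⟨C, hC⟩ := G.exists_configuration h (Finset.mem_filter.mp hp).2
    exact hnot ⟨C, by simp, hC⟩
  · intro C _
    exact G.configurationWeight_eq_term C

end Dicot

/-! ### The grid -/

/-- Vertical edges point to the higher row. -/
theorem gridLabel_lt_of_row_lt {m n : ℕ} {u v : Fin m × Fin n} (h : (u.2 : ℕ) < v.2) :
    gridLabel m n u < gridLabel m n v := by
  have hu := u.1.isLt
  have hlt : (if Even (u.2 : ℕ) then (u.1 : ℕ) else m - 1 - u.1) < m := by split_ifs <;> omega
  have hmul : m * ((u.2 : ℕ) + 1) ≤ m * v.2 := Nat.mul_le_mul_left m h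
  rw [mul_add, mul_one] at hmul
  unfold gridLabel
  omega

theorem kasteleyn_gridDicot (m n : ℕ) (a b₁ b₂ x : ℝ) :
    (gridDicot m n a b₁ b₂ x).kasteleyn =
      gridMatrix m n a x (b₁ + Complex.I * b₂) (-b₁ + Complex.I * b₂) := by
  ext ⟨j, k⟩ ⟨j', k'⟩
  simp only [Dicot.kasteleyn, Dicot.solidEntry, Dicot.dashedEntry, gridDicot, gridMatrix,
    altTridiagonal, Matrix.of_apply, Matrix.add_apply, Matrix.kroneckerMap_apply,
    Matrix.one_apply, SimpleGraph.boxProd_adj, SimpleGraph.pathGraph_adj, SimpleGraph.bot_adj,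
    Prod.mk.injEq, false_and, false_or]
  by_cases hjj : j = j'
  · subst hjj
    by_cases hkk : k = k'
    · subst hkk
      simp
    · have hne : (k : ℕ) ≠ k' := fun e => hkk (Fin.ext e)
      by_cases h1 : (k : ℕ) + 1 = k'
      · have harrow : gridLabel m n (j, k) < gridLabel m n (j, k') :=
          gridLabel_lt_of_row_lt (by simp only; omega)
        simp [hkk, h1, harrow]
      · by_cases h2 : (k' : ℕ) + 1 = k
        · have harrow : ¬ gridLabel m n (j, k) < gridLabel m n (j, k') :=
            (gridLabel_lt_of_row_lt (by simp only; omega)).asymm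
          simp [hkk, h1, h2, harrow]
        · simp [hkk, h1, h2]
  · by_cases hkk : k = k'
    · subst hkk
      have harrow : gridLabel m n (j, k) < gridLabel m n (j', k) ↔
          if Even (k : ℕ) then (j : ℕ) < j' else (j' : ℕ) < j := by
        have := j.isLt
        have := j'.isLt
        unfold gridLabel
        simp only
        split_ifs <;> omega
      by_cases h1 : (j : ℕ) + 1 = j'
      · have h3 : (j : ℕ) < j' := by omega
        by_cases hk : Even (k : ℕ) <;>
          simp [hjj, h1, harrow, hk, h3, h3.not_gt, mul_left_comm Complex.I]
      · by_cases h2 : (j' : ℕ) + 1 = j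
        · have h3 : (j' : ℕ) < j := by omega
          by_cases hk : Even (k : ℕ) <;>
            simp [hjj, h1, h2, harrow, hk, h3, h3.not_gt, mul_left_comm Complex.I]
        · simp [hjj, h1, h2]
    · simp [hjj, hkk]

end

theorem mainTheorem4 (m n : ℕ) (a b₁ b₂ x : ℝ) :
    (gridDicot m n a b₁ b₂ x).partitionFunction =
      (((∏ j ∈ Finset.Icc 1 (m / 2), ∏ k ∈ Finset.Icc 1 (n / 2),
          (x ^ 2 + 4 * a ^ 2 * Real.cos (j * Real.pi / (m + 1)) ^ 2
            + 4 * Real.sqrt (b₁ ^ 2 + b₂ ^ 2) ^ 2 * Real.cos (k * Real.pi / (n + 1)) ^ 2) ^ 2) *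
        (if Even m then
          if Even n then 1 else gridY m a 0 x
        else
          if Even n then gridY n b₁ b₂ x else x * gridY m a 0 x * gridY n b₁ b₂ x) : ℝ) : ℂ) := by
  rw [Dicot.partitionFunction_eq_det, kasteleyn_gridDicot, det_gridMatrix, ← prod_altContinuant]
  have hw : -(((b₁ : ℂ) + Complex.I * b₂) * (-b₁ + Complex.I * b₂)) = b₁ ^ 2 + b₂ ^ 2 := by
    linear_combination (-(b₂ : ℂ) ^ 2) * Complex.I_sq
  rw [hw]
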